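/- Let $n\ge 3$ and let $(W,S)$ be the Coxeter system with generators $S=\{s_0,\dots,s_n\}$ of type $\widetilde A_{n,2}$: the Coxeter diagram restricted to $s_1,\dots,s_n$ is the cycle $s_1 - s_2 - \cdots - s_n - s_1$ (type $\widetilde A_{n-1}$), and $s_0$ is joined exactly to $s_1$ and $s_2$; all edges have label $3$ (so $(s_is_j)^3=1$ for joined generators and $(s_is_j)^2=1$ for distinct non-joined ones). Let $\Delta$ be the $n$-dimensional simplex, with codimension-one faces $\Delta_0,\dots,\Delta_n$ indexed by $s_0,\dots,s_n$. To a nonempty face $\sigma$ of $\Delta$ associate the parabolic subgroup $W_\sigma=\langle s_i : \sigma\subseteq\Delta_i\rangle$. The Davis chamber $D$ is the subcomplex of the first barycentric subdivision of $\Delta$ generated by the barycenters of the faces $\sigma$ with $W_\sigma$ finite, i.e. the union of the simplices all of whose vertices are such barycenters. For a face $\sigma$, let $\Delta_\sigma$ be the union of the faces of $\Delta$ not containing $\sigma$, let $D_\sigma=D\cap\Delta_\sigma$, and let $D_i=D\cap\Delta_i$. "Has the cohomology of a $d$-sphere" means having singular cohomology isomorphic to that of $S^d$ in every degree, as modules,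 for coefficients in any module over any commutative ring. **Theorem.** 1. For $\sigma=\Delta_0$, the space $D_\sigma=\bigcup_{j\ne 0}D_j$ has the cohomology of an $(n-2)$-dimensional sphere. 2. For $\sigma=\Delta$, the space $D_\sigma=D\cap\partial\Delta$ has the cohomology of an $(n-2)$-dimensional sphere. 3. There is a unique nonempty face $\tau$ of $\Delta$ with $\Delta_\tau=\Delta_0\cup\Delta_1\cup\Delta_2$, and the space $D_\tau$ has the cohomology of the circle. 4. For every face $\sigma$ with $\tau\subsetneq\sigma\subsetneq\Delta$, the space $D_\sigma$ is contractible. -/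

import Mathlib

open CategoryTheory

namespace DavisChamber

/-! ### The Coxeter diagram -/

/-- Edges of the diagram on the nodes `0, …, n` (for `3 ≤ n`), each unordered edge listed once:
the nodes `1, …, n` form a cycle `1 - 2 - ⋯ - n - 1`, and the extra node `0` is joined to the
two neighbouring nodes `1` and `2` of the cycle. -/
def diagramEdge (n i j : ℕ) : Prop :=
  (1 ≤ i ∧ i + 1 = j) ∨ (i = 1 ∧ j = n) ∨ (i = 0 ∧ j = 1) ∨ (i = 0 ∧ j = 2)

open Classical in
/-- The Coxeter matrix of type `Ã_{n,2}` with generators `s_0, …, s_n`: two distinct generators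
have `m = 3` if they are joined in the diagram and `m = 2` otherwise. -/
noncomputable def coxeterMatrixAff (n : ℕ) : CoxeterMatrix (Fin (n + 1)) where
  M := Matrix.of fun i j ↦
    if i = j then 1 else if diagramEdge n i j ∨ diagramEdge n j i then 3 else 2
  isSymm := by
    ext i j
    simp only [Matrix.transpose_apply, Matrix.of_apply, eq_comm (a := i) (b := j),
      or_comm (a := diagramEdge n i j)]
  diagonal i := by simp
  off_diagonal i j h := by
    simp only [Matrix.of_apply, if_neg h]
    split_ifs <;> decide

/-! ### The simplex, its faces and the Davis chamber

The simplex `Δ` is the standard simplex in `B → ℝ`, where `B` indexes the generators.  A face of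
`Δ` is given by its nonempty set of vertices `σ : Finset B`; containment of faces is containment
of vertex sets.  The codimension one face attached to the generator `s` is the face opposite to
the vertex `s`. -/

section Simplex

variable {B : Type*} [Fintype B] [DecidableEq B]

/-- The closed face of the standard simplex with vertex set `σ`. -/
def face (σ : Finset B) : Set (B → ℝ) :=
  convexHull ℝ ((fun b ↦ Pi.single b (1 : ℝ)) '' (σ : Set B))

/-- The vertex set of the codimension one face `Δ_s`. -/
def facet (s : B) : Finset B := {s}ᶜ

/-- The boundary `∂Δ` of the simplex. -/
def simplexBoundary (B : Type*) [Fintype B] [DecidableEq B] : Set (B → ℝ) :=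
  ⋃ s : B, face (facet s)

/-- The barycenter of the face with vertex set `σ`. -/
noncomputable def barycenter (σ : Finset B) : B → ℝ :=
  (σ.card : ℝ)⁻¹ • ∑ b ∈ σ, Pi.single b (1 : ℝ)

/-- The generators whose codimension one face contains the face `σ`. -/
def faceGenerators (σ : Finset B) : Set B := {s | σ ⊆ facet s}

/-- `Δ_σ`, the union of the faces of `Δ` that do not contain `σ`. -/
def facesNotContaining (σ : Finset B) : Set (B → ℝ) :=
  ⋃ (F : Finset B) (_ : F.Nonempty ∧ ¬ σ ⊆ F), face F

variable {M : CoxeterMatrix B} {W : Type*} [Group W]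

/-- The parabolic subgroup `W_J = ⟨J⟩`. -/
def parabolic (cs : CoxeterSystem M W) (J : Set B) : Subgroup W :=
  Subgroup.closure (cs.simple '' J)

/-- The Davis chamber `D`, as a subspace of `Δ`: the subcomplex of the barycentric subdivision of
`Δ` generated by the barycenters of the faces whose parabolic subgroup is finite.  Simplices of
the barycentric subdivision are the convex hulls of the barycenters of chains of faces. -/
def chamber (cs : CoxeterSystem M W) : Set (B → ℝ) :=
  ⋃ (C : Set (Finset B)) (_ : IsChain (· ⊆ ·) C ∧
      ∀ F ∈ C, F.Nonempty ∧ Finite (parabolic cs (faceGenerators F))),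
    convexHull ℝ (barycenter '' C)

/-- `D_σ = D ∩ Δ_σ`. -/
def subchamber (cs : CoxeterSystem M W) (σ : Finset B) : Set (B → ℝ) :=
  chamber cs ∩ facesNotContaining σ

end Simplex

/-! ### Singular cohomology -/

/-- The singular cohomology `H^k(X; A)` with coefficients in an `R`-module `A`: the cohomology of
the complex of `R`-linear maps from the singular chains of `X` over `R` to `A`. -/
noncomputable def singularCohomology (R : Type) [CommRing R] (A : ModuleCat.{0} R)
    (X : Type) [TopologicalSpace X] (k : ℕ) : ModuleCat.{0} R :=
  ((((AlgebraicTopology.singularChainComplexFunctor (ModuleCat.{0} R)).obj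
    (ModuleCat.of R R)).obj (TopCat.of X)).linearYonedaObj R A).homology k

/-- `X` has the cohomology of the sphere of dimension `d`: in every degree and for all
coefficients, the cohomology modules of `X` and of the unit sphere in `ℝ^(d+1)` are isomorphic. -/
def HasCohomologyOfSphere (X : Type) [TopologicalSpace X] (d : ℕ) : Prop :=
  ∀ (R : Type) [CommRing R] (A : ModuleCat.{0} R) (k : ℕ),
    Nonempty (singularCohomology R A X k ≅
      singularCohomology R A (Metric.sphere (0 : EuclideanSpace ℝ (Fin (d + 1))) 1) k)

end DavisChamber

namespace DavisChamber

section Braid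

variable {G : Type*} [Group G]

/-- The product `t (k + 1 - d) * ⋯ * t k` of the last `d` of the elements `t 0, …, t k`. -/
def tailProd (t : ℕ → G) (k : ℕ) : ℕ → G
  | 0 => 1
  | d + 1 => t (k - d) * tailProd t k d

variable {t : ℕ → G} {k : ℕ}

lemma commute_tailProd (hc : ∀ i j, i + 1 < j → j < k + 1 → t i * t j = t j * t i) (d i : ℕ)
    (hd : d ≤ k + 1) (hi : i + d < k) : t i * tailProd t k d = tailProd t k d * t i := by
  induction d with
  | zero => simp [tailProd]
  | succ d ih =>
    rw [tailProd, ← mul_assoc, hc i (k - d) (by omega) (by omega), mul_assoc,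
      ih (by omega) (by omega), mul_assoc]

lemma mul_tailProd (hb : ∀ i, i + 1 < k + 1 → t i * t (i + 1) * t i = t (i + 1) * t i * t (i + 1))
    (hc : ∀ i j, i + 1 < j → j < k + 1 → t i * t j = t j * t i) (d i : ℕ)
    (hd : d ≤ k + 1) (hi : k + 1 < i + 1 + d) (hik : i < k) :
    t (i + 1) * tailProd t k d = tailProd t k d * t i := by
  induction d with
  | zero => omega
  | succ d ih =>
    rcases Nat.lt_or_ge (k + 1) (i + 1 + d) with h | h
    · rw [tailProd, ← mul_assoc, ← hc (k - d) (i + 1) (by omega) (by omega), mul_assoc,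
        ih (by omega) h, mul_assoc]
    · obtain ⟨d, rfl⟩ : ∃ e, d = e + 1 := ⟨d - 1, by omega⟩
      have h₁ : k - (d + 1) = i := by omega
      have h₂ : k - d = i + 1 := by omega
      rw [tailProd, tailProd, h₁, h₂, ← mul_assoc, ← mul_assoc, ← hb i (by omega), mul_assoc,
        commute_tailProd hc d i (by omega) (by omega)]
      simp only [mul_assoc]

/-- A group generated by involutions `t 0, …, t (k - 1)` satisfying the braid relations of type
`A_k` is finite. -/
theorem finite_closure_of_braid (t : ℕ → G) (k : ℕ) (hs : ∀ i < k, t i * t i = 1)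
    (hb : ∀ i, i + 1 < k → t i * t (i + 1) * t i = t (i + 1) * t i * t (i + 1))
    (hc : ∀ i j, i + 1 < j → j < k → t i * t j = t j * t i) :
    (Subgroup.closure (t '' Set.Iio k) : Set G).Finite := by
  induction k with
  | zero => simp
  | succ k ih =>
    have hH := ih (fun i hi ↦ hs i (by omega)) (fun i hi ↦ hb i (by omega))
      (fun i j h hj ↦ hc i j h (by omega))
    set H := Subgroup.closure (t '' Set.Iio k) with hHdef
    have htH : ∀ i < k, t i ∈ H := fun i hi ↦ Subgroup.subset_closure ⟨i, hi, rfl⟩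
    let X : Set G := ⋃ d ∈ Set.Iic (k + 1), (fun h ↦ tailProd t k d * h) '' (H : Set G)
    have hX : X.Finite := (Set.finite_Iic _).biUnion fun d _ ↦ hH.image _
    have hmem : ∀ x, x ∈ X ↔ ∃ d ≤ k + 1, ∃ h ∈ H, tailProd t k d * h = x := by
      intro x; simp only [X, Set.mem_iUnion, Set.mem_Iic, Set.mem_image, SetLike.mem_coe, exists_prop]
    have hone : (1 : G) ∈ X := (hmem 1).2 ⟨0, by omega, 1, H.one_mem, by simp [tailProd]⟩
    have hmul : ∀ i < k + 1, ∀ x ∈ X, t i * x ∈ X := by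
      intro i hi x hx
      obtain ⟨d, hd, h, hh, rfl⟩ := (hmem x).1 hx
      rw [hmem]
      rcases lt_trichotomy (i + d) k with hid | hid | hid
      · exact ⟨d, hd, t i * h, H.mul_mem (htH i (by omega)) hh, by
          rw [← mul_assoc, ← mul_assoc, commute_tailProd hc d i hd hid]⟩
      · refine ⟨d + 1, by omega, h, hh, ?_⟩
        rw [tailProd, show k - d = i by omega, mul_assoc]
      · rcases Nat.lt_or_ge (k + 1) (i + d) with h' | h'
        · obtain ⟨i, rfl⟩ : ∃ j, i = j + 1 := ⟨i - 1, by omega⟩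
          exact ⟨d, hd, t i * h, H.mul_mem (htH i (by omega)) hh, by
            rw [← mul_assoc, ← mul_assoc, mul_tailProd hb hc d i hd (by omega) (by omega)]⟩
        · obtain ⟨d, rfl⟩ : ∃ e, d = e + 1 := ⟨d - 1, by omega⟩
          refine ⟨d, by omega, h, hh, ?_⟩
          rw [tailProd, show k - d = i by omega, mul_assoc, ← mul_assoc (t i) (t i), hs i hi,
            one_mul]
    refine hX.subset fun x hx ↦ ?_
    suffices ∀ x ∈ Subgroup.closure (t '' Set.Iio (k + 1)), ∀ y ∈ X, x * y ∈ X by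
      simpa using this x hx 1 hone
    intro x hx
    induction hx using Subgroup.closure_induction'' with
    | one => simp
    | mem x hx => obtain ⟨i, hi, rfl⟩ := hx; exact hmul i hi
    | inv_mem x hx =>
      obtain ⟨i, hi, rfl⟩ := hx
      rw [inv_eq_of_mul_eq_one_left (hs i hi)]
      exact hmul i hi
    | mul x y _ _ hx hy => intro z hz; rw [mul_assoc]; exact hx _ (hy _ hz)

end Braid

section Finite

variable {n : ℕ} {W : Type*} [Group W] (cs : CoxeterSystem (coxeterMatrixAff n) W)

lemma parabolic_mono {B : Type*} {M : CoxeterMatrix B} (cs : CoxeterSystem M W) {J K : Set B}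
    (h : J ⊆ K) : parabolic cs J ≤ parabolic cs K :=
  Subgroup.closure_mono (Set.image_mono h)

lemma coxeterMatrixAff_apply (i j : Fin (n + 1)) [Decidable (i = j)]
    [Decidable (diagramEdge n i j ∨ diagramEdge n j i)] : coxeterMatrixAff n i j =
      if i = j then 1 else if diagramEdge n i j ∨ diagramEdge n j i then 3 else 2 := by
  change (Matrix.of _ : Matrix _ _ ℕ) i j = _
  rw [Matrix.of_apply]
  congr

lemma simple_commute {i j : Fin (n + 1)} (hij : i ≠ j)
    (h : ¬ (diagramEdge n i j ∨ diagramEdge n j i)) :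
    cs.simple i * cs.simple j = cs.simple j * cs.simple i := by
  classical
  have := cs.simple_mul_simple_pow i j
  rw [coxeterMatrixAff_apply, if_neg hij, if_neg h, pow_two] at this
  have h2 := eq_inv_of_mul_eq_one_left this
  simpa using h2

lemma simple_braid {i j : Fin (n + 1)} (hij : i ≠ j)
    (h : diagramEdge n i j ∨ diagramEdge n j i) :
    cs.simple i * cs.simple j * cs.simple i = cs.simple j * cs.simple i * cs.simple j := by
  classical
  have := cs.simple_mul_simple_pow i j
  rw [coxeterMatrixAff_apply, if_neg hij, if_pos h] at this
  have h2 : (cs.simple i * cs.simple j * cs.simple i) *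
      (cs.simple j * cs.simple i * cs.simple j) = 1 := by
    rw [← this]; simp only [pow_succ, pow_zero, one_mul, mul_assoc]
  simpa [mul_assoc] using eq_inv_of_mul_eq_one_left h2

/-- A parabolic subgroup whose generators all lie on a path of the diagram is finite. -/
lemma finite_parabolic_of_path {J : Set (Fin (n + 1))} (p : ℕ → ℕ) (k : ℕ)
    (hp : ∀ i < k, p i < n + 1)
    (hne : ∀ i j, i < j → j < k → p i ≠ p j)
    (hadj : ∀ i, i + 1 < k → diagramEdge n (p i) (p (i + 1)) ∨ diagramEdge n (p (i + 1)) (p i))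
    (hnadj : ∀ i j, i + 1 < j → j < k →
      ¬ (diagramEdge n (p i) (p j) ∨ diagramEdge n (p j) (p i)))
    (hJ : ∀ b ∈ J, ∃ i < k, p i = b) : Finite (parabolic cs J) := by
  have hv : ∀ i < k, ((Fin.ofNat (n + 1) (p i) : Fin (n + 1)) : ℕ) = p i := fun i hi ↦
    Nat.mod_eq_of_lt (hp i hi)
  have hne' : ∀ i j, i < j → j < k → Fin.ofNat (n + 1) (p i) ≠ Fin.ofNat (n + 1) (p j) := by
    intro i j hij hj h
    apply hne i j hij hj
    rw [← hv i (by omega), ← hv j hj, h]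
  have := finite_closure_of_braid (fun i ↦ cs.simple (Fin.ofNat (n + 1) (p i))) k (by simp)
    (fun i hi ↦ simple_braid cs (hne' _ _ (by omega) hi)
      (by rw [hv _ hi, hv i (by omega)]; exact hadj i hi))
    (fun i j hij hj ↦ simple_commute cs (hne' _ _ (by omega) hj)
      (by rw [hv _ hj, hv i (by omega)]; exact hnadj i j hij hj))
  refine (this.subset (SetLike.coe_subset_coe.2 (Subgroup.closure_mono ?_))).to_subtype
  rintro _ ⟨b, hb, rfl⟩
  obtain ⟨i, hi, hib⟩ := hJ b hb
  exact ⟨i, hi, congrArg cs.simple (Fin.ext (by rw [hv i hi, hib]))⟩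

lemma finite_parabolic_of_one_notMem (hn : 3 ≤ n) {J : Set (Fin (n + 1))}
    (hJ : ∀ b ∈ J, (b : ℕ) ≠ 1) : Finite (parabolic cs J) := by
  refine finite_parabolic_of_path cs (fun i ↦ if i = 0 then 0 else i + 1) n ?_ ?_ ?_ ?_ ?_
  · intro i hi; split_ifs <;> omega
  · intro i j hij hj; split_ifs <;> omega
  · intro i hi; grind [diagramEdge]
  · intro i j hij hj; grind [diagramEdge]
  · intro b hb
    have h1 := hJ b hb
    have h2 := b.isLt
    refine ⟨if (b : ℕ) = 0 then 0 else b - 1, ?_, ?_⟩ <;> split_ifs <;> omega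

lemma finite_parabolic_of_two_notMem (hn : 3 ≤ n) {J : Set (Fin (n + 1))}
    (hJ : ∀ b ∈ J, (b : ℕ) ≠ 2) : Finite (parabolic cs J) := by
  refine finite_parabolic_of_path cs (fun i ↦ if i ≤ 1 then i else n + 2 - i) n ?_ ?_ ?_ ?_ ?_
  · intro i hi; split_ifs <;> omega
  · intro i j hij hj; split_ifs <;> omega
  · intro i hi; grind [diagramEdge]
  · intro i j hij hj; grind [diagramEdge]
  · intro b hb
    have h1 := hJ b hb
    have h2 := b.isLt
    refine ⟨if (b : ℕ) ≤ 1 then b else n + 2 - b, ?_, ?_⟩ <;> split_ifs <;> omega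

lemma finite_parabolic_of_zero_notMem (hn : 3 ≤ n) {J : Set (Fin (n + 1))} (j : ℕ) (hj : 3 ≤ j)
    (hjn : j ≤ n) (hJ : ∀ b ∈ J, (b : ℕ) ≠ 0 ∧ (b : ℕ) ≠ j) : Finite (parabolic cs J) := by
  refine finite_parabolic_of_path cs
    (fun i ↦ if j + 1 + i ≤ n then j + 1 + i else j + 1 + i - n) (n - 1) ?_ ?_ ?_ ?_ ?_
  · intro i hi; split_ifs <;> omega
  · intro i j hij hj; split_ifs <;> omega
  · intro i hi; grind [diagramEdge]
  · intro i j hij hj; grind [diagramEdge]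
  · intro b hb
    have h1 := hJ b hb
    have h2 := b.isLt
    refine ⟨if j < (b : ℕ) then b - (j + 1) else b + n - (j + 1), ?_, ?_⟩ <;>
      split_ifs <;> omega

end Finite

section Infinite

variable {B : Type*} [DecidableEq B]

/-- The negatives of the Cartan integers: `-2` for `j = i`, and `1` if `M i j = 3`. -/
def reflectionVec (M : CoxeterMatrix B) (i j : B) : ℤ :=
  if j = i then -2 else if M i j = 3 then 1 else 0

/-- The linear reflection of `B → ℤ` that negates the coordinate `i` and adds it to the
coordinates `j` with `M i j = 3`. -/
def intReflection (M : CoxeterMatrix B) (i : B) : Module.End ℤ (B → ℤ) :=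
  LinearMap.id + (LinearMap.proj i).smulRight (reflectionVec M i)

lemma intReflection_apply (M : CoxeterMatrix B) (i : B) (v : B → ℤ) (j : B) :
    intReflection M i v j = v j + v i * reflectionVec M i j := by
  simp [intReflection]

lemma isLiftable_intReflection (M : CoxeterMatrix B)
    (hM : ∀ i j, i ≠ j → M i j = 2 ∨ M i j = 3) : M.IsLiftable (intReflection M) := by
  intro i j
  have hii : ∀ i, reflectionVec M i i = -2 := fun i ↦ by simp [reflectionVec]
  rcases eq_or_ne i j with rfl | hij
  · rw [M.diagonal, pow_one]
    refine LinearMap.ext fun v ↦ funext fun l ↦ ?_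
    simp only [Module.End.mul_apply, intReflection_apply, hii, Module.End.one_apply]
    ring
  · rcases hM i j hij with h | h
    · have h1 : reflectionVec M i j = 0 := by simp [reflectionVec, hij.symm, h]
      have h2 : reflectionVec M j i = 0 := by simp [reflectionVec, hij, M.symmetric j i, h]
      rw [h]
      refine LinearMap.ext fun v ↦ funext fun l ↦ ?_
      simp only [pow_succ, pow_zero, one_mul, Module.End.mul_apply, intReflection_apply, hii, h1,
        h2, Module.End.one_apply]
      ring
    · have h1 : reflectionVec M i j = 1 := by simp [reflectionVec, hij.symm, h]
      have h2 : reflectionVec M j i = 1 := by simp [reflectionVec, hij, M.symmetric j i, h]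
      rw [h]
      refine LinearMap.ext fun v ↦ funext fun l ↦ ?_
      simp only [pow_succ, pow_zero, one_mul, Module.End.mul_apply, intReflection_apply, hii, h1,
        h2, Module.End.one_apply]
      ring

/-- If every node of the nonempty set `J` has exactly two neighbours in `J`, then the parabolic
subgroup on `J` is infinite: the sum of the coordinates in `J` is an invariant, which vanishes on
the vectors fixed by the subgroup. -/
theorem infinite_parabolic_of_sum_eq_zero {M : CoxeterMatrix B} {W : Type*} [Group W]
    (cs : CoxeterSystem M W) (hM : ∀ i j, i ≠ j → M i j = 2 ∨ M i j = 3) (J : Finset B)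
    (hJ : J.Nonempty) (hsum : ∀ i ∈ J, ∑ j ∈ J, reflectionVec M i j = 0) :
    Infinite (parabolic cs (J : Set B)) := by
  rw [← not_finite_iff_infinite]
  intro hfin
  obtain ⟨j₀, hj₀⟩ := hJ
  have := Fintype.ofFinite (parabolic cs (J : Set B))
  let Φ : W →* Module.End ℤ (B → ℤ) := cs.lift ⟨_, isLiftable_intReflection M hM⟩
  have hΦ : ∀ i, Φ (cs.simple i) = intReflection M i := fun i ↦
    cs.lift_apply_simple (isLiftable_intReflection M hM) i
  have hinv : ∀ i ∈ J, ∀ v, ∑ j ∈ J, intReflection M i v j = ∑ j ∈ J, v j := by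
    intro i hi v
    simp only [intReflection_apply, Finset.sum_add_distrib, ← Finset.mul_sum, hsum i hi, mul_zero,
      add_zero]
  have hinvW : ∀ w ∈ parabolic cs (J : Set B), ∀ v, ∑ j ∈ J, Φ w v j = ∑ j ∈ J, v j := by
    intro w hw
    induction hw using Subgroup.closure_induction'' with
    | one => simp
    | mem x hx => obtain ⟨i, hi, rfl⟩ := hx; rw [hΦ]; exact hinv i hi
    | inv_mem x hx =>
      obtain ⟨i, hi, rfl⟩ := hx
      rw [cs.inv_simple, hΦ]
      exact hinv i hi
    | mul x y _ _ hx hy => intro v; rw [map_mul, Module.End.mul_apply, hx, hy]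
  let e : B → ℤ := Pi.single j₀ 1
  let avg : B → ℤ := ∑ w : parabolic cs (J : Set B), Φ w e
  have hfix : ∀ i ∈ J, intReflection M i avg = avg := by
    intro i hi
    let s : parabolic cs (J : Set B) :=
      ⟨cs.simple i, Subgroup.subset_closure ⟨i, hi, rfl⟩⟩
    rw [← hΦ, map_sum]
    exact Fintype.sum_equiv (Equiv.mulLeft s) _ _ fun w ↦ by
      rw [Equiv.coe_mulLeft, Subgroup.coe_mul, map_mul]; rfl
  have hzero : ∀ i ∈ J, avg i = 0 := by
    intro i hi
    have := congrFun (hfix i hi) i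
    rw [intReflection_apply, reflectionVec, if_pos rfl] at this
    omega
  have h1 : ∑ j ∈ J, avg j = Fintype.card (parabolic cs (J : Set B)) := by
    simp only [avg, Finset.sum_apply]
    rw [Finset.sum_comm, Finset.sum_congr rfl fun w _ ↦ hinvW w.1 w.2 e]
    simp [e, Finset.sum_pi_single', hj₀]
  rw [Finset.sum_eq_zero hzero] at h1
  exact Fintype.card_ne_zero (Nat.cast_eq_zero.1 h1.symm)

variable {n : ℕ} {W : Type*} [Group W] (cs : CoxeterSystem (coxeterMatrixAff n) W)

lemma coxeterMatrixAff_eq_two_or_three (i j : Fin (n + 1)) (hij : i ≠ j) :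
    coxeterMatrixAff n i j = 2 ∨ coxeterMatrixAff n i j = 3 := by
  classical
  rw [coxeterMatrixAff_apply, if_neg hij]
  split_ifs <;> simp

lemma reflectionVec_coxeterMatrixAff (i j : Fin (n + 1))
    [Decidable (diagramEdge n i j ∨ diagramEdge n j i)] :
    reflectionVec (coxeterMatrixAff n) i j = if j = i then -2 else
      if diagramEdge n i j ∨ diagramEdge n j i then 1 else 0 := by
  rw [reflectionVec, coxeterMatrixAff_apply]
  split_ifs <;> simp_all

lemma val_one_eq (hn : 3 ≤ n) : ((1 : Fin (n + 1)) : ℕ) = 1 :=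
  Nat.mod_eq_of_lt (show 1 < n + 1 by omega)

lemma val_two_eq (hn : 3 ≤ n) : ((2 : Fin (n + 1)) : ℕ) = 2 :=
  Nat.mod_eq_of_lt (show 2 < n + 1 by omega)

/-- The nodes of the triangle of the diagram. -/
def triangle (n : ℕ) : Finset (Fin (n + 1)) := {0, 1, 2}

lemma mem_triangle (hn : 3 ≤ n) (b : Fin (n + 1)) : b ∈ triangle n ↔ (b : ℕ) ≤ 2 := by
  have h1 := val_one_eq hn
  have h2 := val_two_eq hn
  simp only [triangle, Finset.mem_insert, Finset.mem_singleton, Fin.ext_iff, h1, h2, Fin.val_zero]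
  omega

lemma infinite_parabolic_triangle (hn : 3 ≤ n) :
    Infinite (parabolic cs (triangle n : Set (Fin (n + 1)))) := by
  classical
  refine infinite_parabolic_of_sum_eq_zero cs coxeterMatrixAff_eq_two_or_three _ ⟨0, by
    simp [triangle]⟩ fun i hi ↦ ?_
  have h1 := val_one_eq hn
  have h2 := val_two_eq hn
  have h01 : (0 : Fin (n + 1)) ∉ ({1, 2} : Finset (Fin (n + 1))) := by
    simp only [Finset.mem_insert, Finset.mem_singleton, Fin.ext_iff, h1, h2, Fin.val_zero]; omega
  have h12 : (1 : Fin (n + 1)) ∉ ({2} : Finset (Fin (n + 1))) := by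
    simp only [Finset.mem_singleton, Fin.ext_iff, h1, h2]; omega
  rw [mem_triangle hn] at hi
  rw [triangle, Finset.sum_insert h01, Finset.sum_insert h12, Finset.sum_singleton]
  simp only [reflectionVec_coxeterMatrixAff, Fin.ext_iff, h1, h2, Fin.val_zero, diagramEdge]
  grind

lemma infinite_parabolic_cycle (hn : 3 ≤ n) :
    Infinite (parabolic cs (({0}ᶜ : Finset (Fin (n + 1))) : Set (Fin (n + 1)))) := by
  classical
  have hmem : ∀ b : Fin (n + 1), b ∈ ({0}ᶜ : Finset (Fin (n + 1))) ↔ (b : ℕ) ≠ 0 := fun b ↦ by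
    rw [Finset.mem_compl, Finset.mem_singleton, Fin.ext_iff]; rfl
  refine infinite_parabolic_of_sum_eq_zero cs coxeterMatrixAff_eq_two_or_three _
    ⟨⟨1, by omega⟩, by rw [hmem]; exact one_ne_zero⟩ fun i hi ↦ ?_
  rw [hmem] at hi
  have hi' := i.isLt
  let p : Fin (n + 1) := ⟨if (i : ℕ) = n then 1 else i + 1, by split_ifs <;> omega⟩
  let m : Fin (n + 1) := ⟨if (i : ℕ) = 1 then n else i - 1, by split_ifs <;> omega⟩
  have hr : ∀ j ∈ ({0}ᶜ : Finset (Fin (n + 1))), reflectionVec (coxeterMatrixAff n) i j =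
      (if j = i then -2 else 0) + (if j = p then 1 else 0) + (if j = m then 1 else 0) := by
    intro j hj
    rw [hmem] at hj
    have hj' := j.isLt
    simp only [reflectionVec_coxeterMatrixAff, Fin.ext_iff, diagramEdge, p, m]
    grind
  have hp : p ∈ ({0}ᶜ : Finset (Fin (n + 1))) := by
    rw [hmem]; simp only [p]; split_ifs <;> omega
  have hm : m ∈ ({0}ᶜ : Finset (Fin (n + 1))) := by
    rw [hmem]; simp only [m]; split_ifs <;> omega
  rw [Finset.sum_congr rfl hr, Finset.sum_add_distrib, Finset.sum_add_distrib,
    Finset.sum_ite_eq', Finset.sum_ite_eq', Finset.sum_ite_eq', if_pos ((hmem i).2 hi), if_pos hp,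
    if_pos hm]
  rfl

/-- The spherical subsets of the diagram are those containing neither the triangle nor the
cycle. -/
theorem finite_parabolic_iff (hn : 3 ≤ n) (J : Set (Fin (n + 1))) :
    Finite (parabolic cs J) ↔ (∃ t : Fin (n + 1), (t : ℕ) ≤ 2 ∧ t ∉ J) ∧ ∃ b, b ≠ 0 ∧ b ∉ J := by
  constructor
  · intro h
    constructor
    · by_contra! hJ
      have hsub : (triangle n : Set (Fin (n + 1))) ⊆ J := fun b hb ↦ hJ b ((mem_triangle hn b).1 hb)
      have := infinite_parabolic_triangle cs hn
      exact not_finite_iff_infinite.2 this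
        (Finite.of_injective _ (Subgroup.inclusion_injective (parabolic_mono cs hsub)))
    · by_contra! hJ
      have hsub : (({0}ᶜ : Finset (Fin (n + 1))) : Set (Fin (n + 1))) ⊆ J := fun b hb ↦
        hJ b (by simpa using hb)
      have := infinite_parabolic_cycle cs hn
      exact not_finite_iff_infinite.2 this
        (Finite.of_injective _ (Subgroup.inclusion_injective (parabolic_mono cs hsub)))
  · rintro ⟨⟨t, ht, htJ⟩, b, hb, hbJ⟩
    have key : ∀ c : Fin (n + 1), c ∉ J → ∀ d ∈ J, (d : ℕ) ≠ c := by
      rintro c hc d hd h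
      exact hc ((Fin.ext h : d = c) ▸ hd)
    have hb' : (b : ℕ) ≠ 0 := fun h ↦ hb (Fin.ext h)
    by_cases h1 : (t : ℕ) = 1 ∨ (b : ℕ) = 1
    · refine finite_parabolic_of_one_notMem cs hn fun d hd ↦ ?_
      rcases h1 with h | h
      · exact (key t htJ d hd).trans_eq h
      · exact (key b hbJ d hd).trans_eq h
    by_cases h2 : (t : ℕ) = 2 ∨ (b : ℕ) = 2
    · refine finite_parabolic_of_two_notMem cs hn fun d hd ↦ ?_
      rcases h2 with h | h
      · exact (key t htJ d hd).trans_eq h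
      · exact (key b hbJ d hd).trans_eq h
    have ht0 : (t : ℕ) = 0 := by omega
    exact finite_parabolic_of_zero_notMem cs hn b (by omega) (by omega) fun d hd ↦
      ⟨ht0 ▸ key t htJ d hd, key b hbJ d hd⟩

end Infinite

section Cohomology

open AlgebraicTopology ContinuousMap

/-- Homotopy equivalent chain complexes have isomorphic cohomology. -/
lemma linearYonedaObj_homology_iso {R : Type} [CommRing R] (A : ModuleCat.{0} R)
    {C D : ChainComplex (ModuleCat.{0} R) ℕ} (e : HomotopyEquiv C D) (k : ℕ) :
    Nonempty ((D.linearYonedaObj R A).homology k ≅ (C.linearYonedaObj R A).homology k) := by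
  have e' := ((linearYoneda R (ModuleCat.{0} R)).obj A).rightOp.mapHomotopyEquiv e
  exact ⟨HomologicalComplex.homologyUnop _ _ ≪≫ (e'.toHomologyIso k).unop ≪≫
    (HomologicalComplex.homologyUnop _ _).symm⟩

/-- Singular cohomology is homotopy invariant. -/
theorem singularCohomology_iso_of_homotopyEquiv (R : Type) [CommRing R] (A : ModuleCat.{0} R)
    {X Y : Type} [TopologicalSpace X] [TopologicalSpace Y] (e : X ≃ₕ Y) (k : ℕ) :
    Nonempty (singularCohomology R A X k ≅ singularCohomology R A Y k) := by
  let F := (singularChainComplexFunctor (ModuleCat.{0} R)).obj (ModuleCat.of R R)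
  let f : TopCat.of X ⟶ TopCat.of Y := TopCat.ofHom e.toFun
  let g : TopCat.of Y ⟶ TopCat.of X := TopCat.ofHom e.invFun
  obtain ⟨h₁⟩ := e.left_inv
  obtain ⟨h₂⟩ := e.right_inv
  have H₁ : TopCat.Homotopy (f ≫ g) (𝟙 _) := h₁
  have H₂ : TopCat.Homotopy (g ≫ f) (𝟙 _) := h₂
  let E : _root_.HomotopyEquiv (F.obj (TopCat.of X)) (F.obj (TopCat.of Y)) :=
    { hom := F.map f
      inv := F.map g
      homotopyHomInvId := (Homotopy.ofEq (F.map_comp f g).symm).trans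
         ((H₁.singularChainComplexFunctorObjMap _).trans (Homotopy.ofEq (F.map_id _)))
      homotopyInvHomId := (Homotopy.ofEq (F.map_comp g f).symm).trans
         ((H₂.singularChainComplexFunctorObjMap _).trans (Homotopy.ofEq (F.map_id _))) }
  exact linearYonedaObj_homology_iso A E.symm k

end Cohomology

section UpperFaces

variable {B : Type*}

lemma barycenter_apply [DecidableEq B] (σ : Finset B) (b : B) :
    barycenter σ b = if b ∈ σ then (σ.card : ℝ)⁻¹ else 0 := by
  simp [barycenter, Finset.sum_apply, Pi.single_apply]

/-- The nonempty sets of vertices of the support of `x` that are upper sets for the order given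
by the coordinates of `x`. -/
def upperFaces (x : B → ℝ) : Set (Finset B) :=
  {F | F.Nonempty ∧ ∀ b ∈ F, 0 < x b ∧ ∀ c, x b ≤ x c → c ∈ F}

lemma isChain_upperFaces (x : B → ℝ) : IsChain (· ⊆ ·) (upperFaces x) := by
  intro F hF G hG _
  by_contra! h
  obtain ⟨b, hbF, hbG⟩ := Finset.not_subset.1 h.1
  obtain ⟨c, hcG, hcF⟩ := Finset.not_subset.1 h.2
  rcases le_total (x b) (x c) with h | h
  · exact hcF ((hF.2 b hbF).2 c h)
  · exact hbG ((hG.2 c hcG).2 b h)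

end UpperFaces

section Faces

variable {B : Type*} [Fintype B] [DecidableEq B]

lemma mem_face {F : Finset B} {x : B → ℝ} :
    x ∈ face F ↔ x ∈ stdSimplex ℝ B ∧ ∀ b ∉ F, x b = 0 := by
  constructor
  · intro hx
    have hconv : Convex ℝ {y : B → ℝ | y ∈ stdSimplex ℝ B ∧ ∀ b ∉ F, y b = 0} := by
      refine (convex_stdSimplex ℝ B).inter (t := {y | ∀ b ∉ F, y b = 0}) ?_
      intro y hy z hz a c _ _ _ b hb
      simp [hy b hb, hz b hb]
    refine convexHull_min ?_ hconv hx
    rintro _ ⟨b, hb, rfl⟩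
    exact ⟨single_mem_stdSimplex ℝ b, fun c hc ↦
      Pi.single_eq_of_ne (show c ≠ b from fun h ↦ hc (by rw [h]; exact hb)) _⟩
  · rintro ⟨⟨h0, h1⟩, hx⟩
    have hsum : ∑ b ∈ F, x b = 1 := by
      rw [← h1]
      exact Finset.sum_subset (Finset.subset_univ F) fun b _ hb ↦ hx b hb
    have hxe : x = ∑ b ∈ F, x b • (Pi.single b (1 : ℝ) : B → ℝ) := by
      ext c
      simp only [Finset.sum_apply, Pi.smul_apply, Pi.single_apply, smul_eq_mul, mul_ite, mul_one,
        mul_zero, Finset.sum_ite_eq]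
      split_ifs with h
      · rfl
      · exact hx c h
    rw [hxe]
    exact (convex_convexHull ℝ _).sum_mem (fun b _ ↦ h0 b) hsum fun b hb ↦
      subset_convexHull ℝ _ ⟨b, hb, rfl⟩

lemma mem_face_facet {s : B} {x : B → ℝ} :
    x ∈ face (facet s) ↔ x ∈ stdSimplex ℝ B ∧ x s = 0 := by
  simp [mem_face, facet]

lemma mem_facesNotContaining {σ : Finset B} {x : B → ℝ} :
    x ∈ facesNotContaining σ ↔ x ∈ stdSimplex ℝ B ∧ ∃ s ∈ σ, x s = 0 := by
  simp only [facesNotContaining, Set.mem_iUnion, mem_face]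
  constructor
  · rintro ⟨F, ⟨-, hF⟩, hx, h0⟩
    obtain ⟨s, hs, hsF⟩ := Finset.not_subset.1 hF
    exact ⟨hx, s, hs, h0 s hsF⟩
  · rintro ⟨hx, s, hs, hxs⟩
    refine ⟨facet s, ⟨?_, ?_⟩, hx, ?_⟩
    · by_contra hF
      rw [Finset.not_nonempty_iff_eq_empty] at hF
      have : ∑ b, x b = 0 := Finset.sum_eq_zero fun b _ ↦ by
        have : b ∉ facet s := by simp [hF]
        rw [facet, Finset.mem_compl, Finset.mem_singleton, not_not] at this
        rw [this, hxs]
      exact zero_ne_one (this.symm.trans hx.2)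
    · intro h
      simpa [facet] using h hs
    · intro b hb
      rw [facet, Finset.mem_compl, Finset.mem_singleton, not_not] at hb
      rw [hb, hxs]

lemma facesNotContaining_eq (σ : Finset B) :
    facesNotContaining σ = ⋃ s ∈ σ, face (facet s) := by
  ext x
  simp only [mem_facesNotContaining, Set.mem_iUnion, mem_face_facet, exists_prop]
  tauto

lemma barycenter_mem_stdSimplex {σ : Finset B} (hσ : σ.Nonempty) :
    barycenter σ ∈ stdSimplex ℝ B := by
  constructor
  · intro b
    rw [barycenter_apply]
    split_ifs <;> positivity
  · simp [barycenter_apply, hσ.card_ne_zero]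

lemma barycenter_mem_facesNotContaining {σ τ : Finset B} (hσ : σ.Nonempty) :
    barycenter σ ∈ facesNotContaining τ ↔ ¬ τ ⊆ σ := by
  have hc : (σ.card : ℝ)⁻¹ ≠ 0 := inv_ne_zero (Nat.cast_ne_zero.2 hσ.card_ne_zero)
  rw [mem_facesNotContaining, and_iff_right (barycenter_mem_stdSimplex hσ), Finset.not_subset]
  refine exists_congr fun s ↦ and_congr_right fun _ ↦ ?_
  rw [barycenter_apply]
  split_ifs with h <;> simp [h, hc]

/-- A face is determined by the union of the faces not containing it. -/
lemma facesNotContaining_injective [Nontrivial B] :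
    Function.Injective (facesNotContaining : Finset B → Set (B → ℝ)) := by
  intro σ τ h
  ext s
  obtain ⟨b, hb⟩ := exists_ne s
  have hne : (facet s).Nonempty := ⟨b, by simpa [facet] using hb⟩
  have h1 : ∀ ρ : Finset B, ¬ ρ ⊆ facet s ↔ s ∈ ρ := fun ρ ↦ by
    rw [facet, Finset.subset_compl_comm, Finset.singleton_subset_iff, Finset.mem_compl, not_not]
  rw [← h1, ← h1 τ, ← barycenter_mem_facesNotContaining hne, h,
    barycenter_mem_facesNotContaining hne]

/-- Every point lies in the simplex of the barycentric subdivision spanned by the barycenters of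
its upper faces. -/
lemma smul_mem_convexHull_upperFaces (x : B → ℝ) (hx : ∀ b, 0 ≤ x b) (hs : 0 < ∑ b, x b) :
    (∑ b, x b)⁻¹ • x ∈ convexHull ℝ (barycenter '' upperFaces x) := by
  induction hk : (Finset.univ.filter fun b ↦ 0 < x b).card using Nat.strong_induction_on
    generalizing x with
  | _ k ih =>
  subst hk
  set S := Finset.univ.filter fun b ↦ 0 < x b with hS
  have hmemS : ∀ b, b ∈ S ↔ 0 < x b := by simp [hS]
  have hSne : S.Nonempty := by
    obtain ⟨b, -, hb⟩ := Finset.exists_lt_of_sum_lt (s := Finset.univ) (f := fun _ ↦ (0 : ℝ))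
      (g := x) (by simpa using hs)
    exact ⟨b, (hmemS b).2 hb⟩
  obtain ⟨m, hmS, hm⟩ := S.exists_min_image x hSne
  have hm0 : 0 < x m := (hmemS m).1 hmS
  have hSU : S ∈ upperFaces x :=
    ⟨hSne, fun b hb ↦ ⟨(hmemS b).1 hb, fun c hc ↦ (hmemS c).2 (((hmemS b).1 hb).trans_le hc)⟩⟩
  let y : B → ℝ := fun b ↦ if b ∈ S then x b - x m else 0
  have hxy : x = (x m * S.card) • barycenter S + y := by
    ext b
    have hc : (S.card : ℝ) ≠ 0 := Nat.cast_ne_zero.2 hSne.card_ne_zero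
    simp only [Pi.add_apply, Pi.smul_apply, barycenter_apply, y, smul_eq_mul]
    split_ifs with hb
    · field_simp; ring
    · have := mt (hmemS b).2 hb
      linarith [hx b]
  have hy0 : ∀ b, 0 ≤ y b := by
    intro b
    simp only [y]
    split_ifs with hb
    · linarith [hm b hb]
    · rfl
  have hyx : ∀ b, 0 < y b → b ∈ S ∧ y b = x b - x m := by
    intro b hb
    simp only [y] at hb ⊢
    split_ifs at hb ⊢ with h
    · exact ⟨h, rfl⟩
    · exact absurd hb (lt_irrefl 0)
  have hsum : ∑ b, x b = x m * S.card + ∑ b, y b := by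
    conv_lhs => rw [hxy]
    simp only [Pi.add_apply, Pi.smul_apply, Finset.sum_add_distrib, ← Finset.mul_sum,
      (barycenter_mem_stdSimplex hSne).2, smul_eq_mul, mul_one]
  have hc : 0 < x m * S.card := mul_pos hm0 (Nat.cast_pos.2 hSne.card_pos)
  rcases (Finset.sum_nonneg fun b _ ↦ hy0 b : 0 ≤ ∑ b, y b).eq_or_lt with hy | hy
  · have hyz : y = 0 := funext fun b ↦
      (Finset.sum_eq_zero_iff_of_nonneg fun b _ ↦ hy0 b).1 hy.symm b (Finset.mem_univ b)
    have : (∑ b, x b)⁻¹ • x = barycenter S := by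
      rw [hyz, add_zero] at hxy
      rw [hsum, ← hy, add_zero, inv_smul_eq_iff₀ hc.ne']
      exact hxy
    rw [this]
    exact subset_convexHull ℝ _ ⟨S, hSU, rfl⟩
  · have hlt : (Finset.univ.filter fun b ↦ 0 < y b).card < S.card := by
      refine Finset.card_lt_card ⟨fun b hb ↦ (hyx b (by simpa using hb)).1, fun h ↦ ?_⟩
      have := (Finset.mem_filter.1 (h hmS)).2
      have hym : y m = 0 := (if_pos hmS).trans (sub_self _)
      exact this.ne' hym
    have hsub : upperFaces y ⊆ upperFaces x := by
      rintro F ⟨hF, hFy⟩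
      refine ⟨hF, fun b hb ↦ ?_⟩
      obtain ⟨hb0, hbc⟩ := hFy b hb
      obtain ⟨hbS, hyb⟩ := hyx b hb0
      refine ⟨(hmemS b).1 hbS, fun c hxc ↦ hbc c ?_⟩
      have hcS : c ∈ S := (hmemS c).2 (((hmemS b).1 hbS).trans_le hxc)
      have hyc : y c = x c - x m := if_pos hcS
      linarith
    have h1 := convexHull_mono (Set.image_mono hsub) (ih _ hlt y hy0 hy rfl)
    have h2 := subset_convexHull ℝ _ (Set.mem_image_of_mem barycenter hSU)
    have h3 := (convex_convexHull ℝ (barycenter '' upperFaces x)) h2 h1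
      (a := (∑ b, x b)⁻¹ * (x m * S.card)) (b := (∑ b, x b)⁻¹ * ∑ b, y b)
      (mul_nonneg (inv_nonneg.2 hs.le) hc.le) (mul_nonneg (inv_nonneg.2 hs.le) hy.le) (by
        rw [← mul_add, ← hsum, inv_mul_cancel₀ hs.ne'])
    convert h3 using 1
    rw [smul_smul, mul_assoc _ (∑ b, y b), mul_inv_cancel₀ hy.ne', mul_one, mul_smul, ← smul_add]
    exact congrArg _ hxy

variable {M : CoxeterMatrix B} {W : Type*} [Group W]

lemma finite_parabolic_of_subset (cs : CoxeterSystem M W) {F G : Finset B} (h : F ⊆ G)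
    (hF : Finite (parabolic cs (faceGenerators F))) :
    Finite (parabolic cs (faceGenerators G)) :=
  have hGF : faceGenerators G ⊆ faceGenerators F := fun _ (hs : G ⊆ facet _) ↦ h.trans hs
  Finite.of_injective _ (Subgroup.inclusion_injective (parabolic_mono cs hGF))

/-- A point of the simplex lies in the Davis chamber if and only if the parabolic subgroup attached
to the set of its largest coordinates is finite. -/
theorem mem_chamber (cs : CoxeterSystem M W) {x : B → ℝ} :
    x ∈ chamber cs ↔ x ∈ stdSimplex ℝ B ∧ Finite (parabolic cs (faceGenerators
      (Finset.univ.filter fun b ↦ ∀ c, x c ≤ x b))) := by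
  simp only [chamber, Set.mem_iUnion, exists_prop]
  constructor
  · rintro ⟨C, ⟨hC, hCF⟩, hx⟩
    refine ⟨convexHull_min ?_ (convex_stdSimplex ℝ B) hx, ?_⟩
    · rintro _ ⟨F, hF, rfl⟩
      exact barycenter_mem_stdSimplex (hCF F hF).1
    · have hCne : C.Nonempty := by
        rw [← Set.image_nonempty (f := barycenter), ← convexHull_nonempty_iff (𝕜 := ℝ)]
        exact ⟨x, hx⟩
      obtain ⟨F₀, hF₀, hmin⟩ := C.exists_min_image Finset.card C.toFinite hCne
      have hF₀' : ∀ F ∈ C, F₀ ⊆ F := by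
        intro F hF
        rcases hC.total hF₀ hF with h | h
        · exact h
        · exact (Finset.eq_of_subset_of_card_le h (hmin F hF)).symm.subset
      refine finite_parabolic_of_subset cs (F := F₀) (fun b hb ↦ ?_) (hCF F₀ hF₀).2
      rw [Finset.mem_filter, and_iff_right (Finset.mem_univ b)]
      intro c
      have hconv : Convex ℝ {y : B → ℝ | y c ≤ y b} := by
        intro y hy z hz a d ha hd _
        simp only [Set.mem_ofPred_eq, Pi.add_apply, Pi.smul_apply, smul_eq_mul] at *
        gcongr
      refine convexHull_min ?_ hconv hx
      rintro _ ⟨F, hF, rfl⟩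
      simp only [Set.mem_ofPred_eq, barycenter_apply, if_pos (hF₀' F hF hb)]
      split_ifs
      · rfl
      · positivity
  · rintro ⟨hx, hfin⟩
    refine ⟨upperFaces x, ⟨isChain_upperFaces x, fun F hF ↦ ⟨hF.1,
      finite_parabolic_of_subset cs (fun b hb ↦ ?_) hfin⟩⟩, ?_⟩
    · obtain ⟨c, hc⟩ := hF.1
      exact (hF.2 c hc).2 b ((Finset.mem_filter.1 hb).2 c)
    · have := smul_mem_convexHull_upperFaces x hx.1 (by rw [hx.2]; exact one_pos)
      rwa [hx.2, inv_one, one_smul] at this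

end Faces

section Sphere

/-- The points of the cube `[0, 1]^(d + 2)` having a coordinate `1` and a coordinate `0`. -/
def cubeSphere (d : ℕ) : Set (Fin (d + 2) → ℝ) :=
  {y | (∀ i, y i ∈ Set.Icc 0 1) ∧ (∃ i, y i = 1) ∧ ∃ i, y i = 0}

/-- The largest coordinate. -/
noncomputable def maxCoord {d : ℕ} (z : Fin (d + 2) → ℝ) : ℝ :=
  Finset.univ.sup' Finset.univ_nonempty z

/-- The smallest coordinate. -/
noncomputable def minCoord {d : ℕ} (z : Fin (d + 2) → ℝ) : ℝ :=
  Finset.univ.inf' Finset.univ_nonempty z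

variable {d : ℕ}

lemma continuous_maxCoord : Continuous (maxCoord (d := d)) :=
  Continuous.finset_sup'_apply _ fun i _ ↦ continuous_apply i

lemma continuous_minCoord : Continuous (minCoord (d := d)) :=
  Continuous.finset_inf'_apply _ fun i _ ↦ continuous_apply i

lemma le_maxCoord (z : Fin (d + 2) → ℝ) (i : Fin (d + 2)) : z i ≤ maxCoord z :=
  Finset.le_sup' z (Finset.mem_univ i)

lemma minCoord_le (z : Fin (d + 2) → ℝ) (i : Fin (d + 2)) : minCoord z ≤ z i :=
  Finset.inf'_le z (Finset.mem_univ i)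

lemma maxCoord_affine {y : Fin (d + 2) → ℝ} (hy : y ∈ cubeSphere d) {a c : ℝ} (ha : 0 ≤ a) :
    maxCoord (fun i ↦ a * y i + c) = a + c := by
  obtain ⟨hy, ⟨i, hi⟩, -⟩ := hy
  refine le_antisymm (Finset.sup'_le _ _ fun j _ ↦ ?_) ?_
  · linarith [mul_le_of_le_one_right ha (hy j).2]
  · have := le_maxCoord (fun i ↦ a * y i + c) i
    rwa [hi, mul_one] at this

lemma minCoord_affine {y : Fin (d + 2) → ℝ} (hy : y ∈ cubeSphere d) {a c : ℝ} (ha : 0 ≤ a) :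
    minCoord (fun i ↦ a * y i + c) = c := by
  obtain ⟨hy, -, ⟨i, hi⟩⟩ := hy
  refine le_antisymm ?_ (Finset.le_inf' _ _ fun j _ ↦ ?_)
  · have := minCoord_le (fun i ↦ a * y i + c) i
    rwa [hi, mul_zero, zero_add] at this
  · linarith [mul_nonneg ha (hy j).1]

/-- The rescaling of a nonconstant vector to one with largest coordinate `1` and smallest
coordinate `0`. -/
noncomputable def rescale (z : Fin (d + 2) → ℝ) (i : Fin (d + 2)) : ℝ :=
  (z i - minCoord z) / (maxCoord z - minCoord z)

lemma minCoord_lt_maxCoord {z : Fin (d + 2) → ℝ} {i j : Fin (d + 2)} (h : z i ≠ z j) :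
    minCoord z < maxCoord z := by
  rcases h.lt_or_gt with h | h
  · exact (minCoord_le z i).trans_lt (h.trans_le (le_maxCoord z j))
  · exact (minCoord_le z j).trans_lt (h.trans_le (le_maxCoord z i))

lemma rescale_mem {z : Fin (d + 2) → ℝ} (h : minCoord z < maxCoord z) :
    rescale z ∈ cubeSphere d := by
  have h' := sub_pos.2 h
  refine ⟨fun i ↦ ⟨div_nonneg (sub_nonneg.2 (minCoord_le z i)) h'.le,
    (div_le_one h').2 (sub_le_sub_right (le_maxCoord z i) _)⟩, ?_, ?_⟩
  · obtain ⟨i, -, hi⟩ := Finset.exists_mem_eq_sup' Finset.univ_nonempty z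
    exact ⟨i, by rw [rescale, ← hi]; exact div_self h'.ne'⟩
  · obtain ⟨i, -, hi⟩ := Finset.exists_mem_eq_inf' Finset.univ_nonempty z
    exact ⟨i, by rw [rescale, ← hi]; exact (congrArg (· / _) (sub_self _)).trans (zero_div _)⟩

lemma rescale_affine {y z : Fin (d + 2) → ℝ} (hy : y ∈ cubeSphere d) {a c : ℝ} (ha : 0 < a)
    (hz : ∀ i, z i = a * y i + c) : rescale z = y := by
  obtain rfl : z = fun i ↦ a * y i + c := funext hz
  ext i
  rw [rescale, maxCoord_affine hy ha.le, minCoord_affine hy ha.le, add_sub_cancel_right,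
    add_sub_cancel_right, mul_div_cancel_left₀ _ ha.ne']

/-- The vector of differences with the coordinate `0`. -/
noncomputable def differences (y : Fin (d + 2) → ℝ) : EuclideanSpace ℝ (Fin (d + 1)) :=
  WithLp.toLp 2 fun i ↦ y i.succ - y 0

lemma differences_ne_zero {y : Fin (d + 2) → ℝ} (hy : y ∈ cubeSphere d) : differences y ≠ 0 := by
  obtain ⟨-, ⟨i, hi⟩, j, hj⟩ := hy
  intro h
  have h0 : ∀ k, y k = y 0 := by
    intro k
    refine Fin.cases rfl (fun k ↦ ?_) k
    exact sub_eq_zero.1 (congrArg (fun v : EuclideanSpace ℝ (Fin (d + 1)) ↦ v k) h)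
  rw [h0] at hi hj
  exact zero_ne_one (hj.symm.trans hi)

lemma continuous_differences : Continuous (differences (d := d)) := by
  unfold differences
  fun_prop

lemma minCoord_lt_maxCoord_cons (w : Metric.sphere (0 : EuclideanSpace ℝ (Fin (d + 1))) 1) :
    minCoord (Fin.cons 0 w.1 : Fin (d + 2) → ℝ) < maxCoord (Fin.cons 0 w.1 : Fin (d + 2) → ℝ) := by
  obtain ⟨i, hi⟩ : ∃ i, w.1 i ≠ 0 := by
    by_contra! h
    have hw : w.1 = 0 := PiLp.ext h
    have h1 := norm_eq_of_mem_sphere w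
    rw [hw, norm_zero] at h1
    exact zero_ne_one h1
  exact minCoord_lt_maxCoord (i := i.succ) (j := 0) (by simpa using hi)

/-- The nonconstant vectors of the cube with largest coordinate `1` and smallest coordinate `0`
form a sphere. -/
noncomputable def cubeSphereHomeomorph (d : ℕ) :
    cubeSphere d ≃ₜ Metric.sphere (0 : EuclideanSpace ℝ (Fin (d + 1))) 1 where
  toFun y := ⟨‖differences y.1‖⁻¹ • differences y.1, by
    rw [mem_sphere_zero_iff_norm, norm_smul, norm_inv, norm_norm,
      inv_mul_cancel₀ (norm_ne_zero_iff.2 (differences_ne_zero y.2))]⟩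
  invFun w := ⟨rescale (Fin.cons 0 w.1 : Fin (d + 2) → ℝ), rescale_mem (minCoord_lt_maxCoord_cons w)⟩
  left_inv y := by
    refine Subtype.ext (rescale_affine y.2
      (inv_pos.2 (norm_pos_iff.2 (differences_ne_zero y.2)))
      (c := -(‖differences y.1‖⁻¹ * y.1 0)) fun i ↦ ?_)
    refine Fin.cases ?_ (fun i ↦ ?_) i
    · simp
    · simp [differences]; ring
  right_inv w := by
    have h := sub_pos.2 (minCoord_lt_maxCoord_cons w)
    set z : Fin (d + 2) → ℝ := Fin.cons 0 w.1 with hz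
    have hd : differences (rescale z) = (maxCoord z - minCoord z)⁻¹ • w.1 := by
      ext i
      simp only [differences, rescale, PiLp.smul_apply, smul_eq_mul]
      rw [hz, Fin.cons_succ, Fin.cons_zero, ← hz]
      ring
    apply Subtype.ext
    change ‖differences (rescale z)‖⁻¹ • differences (rescale z) = w.1
    rw [hd, norm_smul, norm_eq_of_mem_sphere w, mul_one, norm_inv, inv_inv, Real.norm_of_nonneg h.le,
      smul_smul, mul_inv_cancel₀ h.ne', one_smul]
  continuous_toFun := by
    have h : Continuous fun y : cubeSphere d ↦ differences y.1 :=
      continuous_differences.comp continuous_subtype_val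
    exact ((h.norm.inv₀ fun y ↦ norm_ne_zero_iff.2 (differences_ne_zero y.2)).smul h).subtype_mk _
  continuous_invFun := by
    have h : Continuous fun w : Metric.sphere (0 : EuclideanSpace ℝ (Fin (d + 1))) 1 ↦
        (Fin.cons 0 w.1 : Fin (d + 2) → ℝ) := by
      refine continuous_pi fun i ↦ Fin.cases ?_ (fun i ↦ ?_) i
      · simpa using continuous_const
      · simp only [Fin.cons_succ]; fun_prop
    refine Continuous.subtype_mk (continuous_pi fun i ↦ ?_) _
    exact (((continuous_apply i).comp h).sub (continuous_minCoord.comp h)).div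
      ((continuous_maxCoord.comp h).sub (continuous_minCoord.comp h))
      fun w ↦ (sub_pos.2 (minCoord_lt_maxCoord_cons w)).ne'

end Sphere

section CubeModel

open ContinuousMap

lemma continuous_coord {ι : Type*} {Y : Set (ι → ℝ)} (i : ι) : Continuous fun y : Y ↦ y.1 i :=
  (continuous_apply i).comp continuous_subtype_val

variable {n : ℕ}

/-- The cubical model of `D_σ`: the points of the cube `[0, 1]^(n + 1)` with a coordinate `1` on the
triangle of the diagram, a coordinate `1` on the cycle, and a coordinate `0` in `σ`. -/
def cubeModel (n : ℕ) (σ : Finset (Fin (n + 1))) : Set (Fin (n + 1) → ℝ) :=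
  {x | (∀ b, x b ∈ Set.Icc 0 1) ∧ (∃ t : Fin (n + 1), (t : ℕ) ≤ 2 ∧ x t = 1) ∧
    (∃ b, b ≠ 0 ∧ x b = 1) ∧ ∃ s ∈ σ, x s = 0}

lemma mem_subchamber (hn : 3 ≤ n) {W : Type*} [Group W]
    (cs : CoxeterSystem (coxeterMatrixAff n) W) (σ : Finset (Fin (n + 1)))
    {x : Fin (n + 1) → ℝ} : x ∈ subchamber cs σ ↔ x ∈ stdSimplex ℝ (Fin (n + 1)) ∧
      (∃ t : Fin (n + 1), (t : ℕ) ≤ 2 ∧ ∀ c, x c ≤ x t) ∧ (∃ b, b ≠ 0 ∧ ∀ c, x c ≤ x b) ∧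
      ∃ s ∈ σ, x s = 0 := by
  have h : ∀ (F : Finset (Fin (n + 1))) b, b ∉ faceGenerators F ↔ b ∈ F := fun F b ↦ by
    change ¬ F ⊆ facet b ↔ _
    rw [facet, Finset.subset_compl_comm, Finset.singleton_subset_iff, Finset.mem_compl, not_not]
  rw [subchamber, Set.mem_inter_iff, mem_chamber, mem_facesNotContaining, finite_parabolic_iff cs hn]
  simp only [h, Finset.mem_filter, Finset.mem_univ, true_and]
  tauto

lemma norm_eq_of_forall_le {x : Fin (n + 1) → ℝ} (hx : ∀ b, 0 ≤ x b) {t : Fin (n + 1)}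
    (ht : ∀ c, x c ≤ x t) : ‖x‖ = x t := by
  refine le_antisymm ((pi_norm_le_iff_of_nonneg (hx t)).2 fun c ↦ ?_) ?_
  · rw [Real.norm_of_nonneg (hx c)]; exact ht c
  · exact (Real.norm_of_nonneg (hx t)).symm.trans_le (norm_le_pi_norm x t)

lemma sum_pos_of_mem_cubeModel {σ : Finset (Fin (n + 1))} {y : Fin (n + 1) → ℝ}
    (hy : y ∈ cubeModel n σ) : 0 < ∑ b, y b := by
  obtain ⟨h, ⟨t, -, ht⟩, -⟩ := hy
  exact Finset.sum_pos' (fun b _ ↦ (h b).1) ⟨t, Finset.mem_univ t, ht ▸ one_pos⟩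

lemma norm_eq_one_of_mem_cubeModel {σ : Finset (Fin (n + 1))} {y : Fin (n + 1) → ℝ}
    (hy : y ∈ cubeModel n σ) : ‖y‖ = 1 := by
  obtain ⟨h, ⟨t, -, ht⟩, -⟩ := hy
  rw [← ht]
  exact norm_eq_of_forall_le (fun b ↦ (h b).1) fun c ↦ ht ▸ (h c).2

lemma norm_pos_of_mem_stdSimplex {x : Fin (n + 1) → ℝ} (hx : x ∈ stdSimplex ℝ (Fin (n + 1))) :
    0 < ‖x‖ := by
  rw [norm_pos_iff]
  rintro rfl
  simpa using hx.2

lemma inv_norm_smul_mem_cubeModel (hn : 3 ≤ n) {W : Type*} [Group W]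
    (cs : CoxeterSystem (coxeterMatrixAff n) W) {σ : Finset (Fin (n + 1))}
    {x : Fin (n + 1) → ℝ} (hx : x ∈ subchamber cs σ) : ‖x‖⁻¹ • x ∈ cubeModel n σ := by
  obtain ⟨hΔ, ⟨t, ht2, ht⟩, ⟨b, hb0, hb⟩, s, hs, hxs⟩ := (mem_subchamber hn cs σ).1 hx
  have hpos := norm_pos_of_mem_stdSimplex hΔ
  refine ⟨fun c ↦ ⟨mul_nonneg (inv_nonneg.2 hpos.le) (hΔ.1 c), ?_⟩, ⟨t, ht2, ?_⟩, ⟨b, hb0, ?_⟩,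
    s, hs, by simp [hxs]⟩
  · rw [Pi.smul_apply, smul_eq_mul, inv_mul_le_one₀ hpos, norm_eq_of_forall_le hΔ.1 ht]
    exact ht c
  · rw [Pi.smul_apply, smul_eq_mul, ← norm_eq_of_forall_le hΔ.1 ht, inv_mul_cancel₀ hpos.ne']
  · rw [Pi.smul_apply, smul_eq_mul, ← norm_eq_of_forall_le hΔ.1 hb, inv_mul_cancel₀ hpos.ne']

lemma inv_sum_smul_mem_subchamber (hn : 3 ≤ n) {W : Type*} [Group W]
    (cs : CoxeterSystem (coxeterMatrixAff n) W) {σ : Finset (Fin (n + 1))}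
    {y : Fin (n + 1) → ℝ} (hy : y ∈ cubeModel n σ) : (∑ b, y b)⁻¹ • y ∈ subchamber cs σ := by
  have hpos := sum_pos_of_mem_cubeModel hy
  obtain ⟨h, ⟨t, ht2, ht⟩, ⟨b, hb0, hb⟩, s, hs, hys⟩ := hy
  have hinv := inv_nonneg.2 hpos.le
  refine (mem_subchamber hn cs σ).2 ⟨⟨fun c ↦ mul_nonneg hinv (h c).1, ?_⟩, ⟨t, ht2, fun c ↦ ?_⟩,
    ⟨b, hb0, fun c ↦ ?_⟩, s, hs, by simp [hys]⟩
  · simp only [Pi.smul_apply, smul_eq_mul, ← Finset.mul_sum]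
    exact inv_mul_cancel₀ hpos.ne'
  · exact mul_le_mul_of_nonneg_left (ht ▸ (h c).2) hinv
  · exact mul_le_mul_of_nonneg_left (hb ▸ (h c).2) hinv

/-- `D_σ` is homeomorphic to its cubical model, by rescaling the largest coordinate to `1`. -/
noncomputable def subchamberHomeomorph (hn : 3 ≤ n) {W : Type*} [Group W]
    (cs : CoxeterSystem (coxeterMatrixAff n) W) (σ : Finset (Fin (n + 1))) :
    subchamber cs σ ≃ₜ cubeModel n σ where
  toFun x := ⟨‖x.1‖⁻¹ • x.1, inv_norm_smul_mem_cubeModel hn cs x.2⟩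
  invFun y := ⟨(∑ b, y.1 b)⁻¹ • y.1, inv_sum_smul_mem_subchamber hn cs y.2⟩
  left_inv x := by
    have hΔ := ((mem_subchamber hn cs σ).1 x.2).1
    apply Subtype.ext
    simp only [Pi.smul_apply, smul_eq_mul, ← Finset.mul_sum, hΔ.2, mul_one, inv_inv]
    exact smul_inv_smul₀ (norm_pos_of_mem_stdSimplex hΔ).ne' _
  right_inv y := by
    have hpos := sum_pos_of_mem_cubeModel y.2
    apply Subtype.ext
    simp only [norm_smul, norm_eq_one_of_mem_cubeModel y.2, mul_one, norm_inv, inv_inv,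
      Real.norm_of_nonneg hpos.le]
    exact smul_inv_smul₀ hpos.ne' _
  continuous_toFun := by
    have hc : Continuous fun x : subchamber cs σ ↦ x.1 := continuous_subtype_val
    exact ((hc.norm.inv₀ fun x ↦ (norm_pos_of_mem_stdSimplex
      ((mem_subchamber hn cs σ).1 x.2).1).ne').smul hc).subtype_mk _
  continuous_invFun := by
    have hc : Continuous fun y : cubeModel n σ ↦ y.1 := continuous_subtype_val
    have hs : Continuous fun y : cubeModel n σ ↦ ∑ b, y.1 b :=
      continuous_finsetSum _ fun b _ ↦ continuous_coord b
    exact ((hs.inv₀ fun y ↦ (sum_pos_of_mem_cubeModel y.2).ne').smul hc).subtype_mk _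

/-- Two maps to the cubical model are homotopic, by a straight line homotopy, if they share
coordinates equal to `1` or `0` as in the definition of the model. -/
lemma cubeModel_homotopic {X : Type*} [TopologicalSpace X] {σ : Finset (Fin (n + 1))}
    (f g : C(X, cubeModel n σ))
    (h₁ : ∀ x, ∃ t : Fin (n + 1), (t : ℕ) ≤ 2 ∧ (f x).1 t = 1 ∧ (g x).1 t = 1)
    (h₂ : ∀ x, ∃ b, b ≠ 0 ∧ (f x).1 b = 1 ∧ (g x).1 b = 1)
    (h₃ : ∀ x, ∃ s ∈ σ, (f x).1 s = 0 ∧ (g x).1 s = 0) : f.Homotopic g := by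
  refine ⟨⟨⟨fun p ↦ ⟨fun b ↦ (1 - (p.1 : ℝ)) * (f p.2).1 b + p.1 * (g p.2).1 b, ?_⟩, ?_⟩, ?_, ?_⟩⟩
  · obtain ⟨u, x⟩ := p
    obtain ⟨t, ht, ht₁, ht₂⟩ := h₁ x
    obtain ⟨b, hb, hb₁, hb₂⟩ := h₂ x
    obtain ⟨s, hs, hs₁, hs₂⟩ := h₃ x
    refine ⟨fun c ↦ ?_, ⟨t, ht, by simp [ht₁, ht₂]⟩, ⟨b, hb, by simp [hb₁, hb₂]⟩, s, hs, by
      simp [hs₁, hs₂]⟩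
    exact (convex_Icc (0 : ℝ) 1) ((f x).2.1 c) ((g x).2.1 c) (sub_nonneg.2 u.2.2) u.2.1 (by ring)
  · refine Continuous.subtype_mk (continuous_pi fun b ↦ ?_) _
    have hu : Continuous fun p : unitInterval × X ↦ (p.1 : ℝ) :=
      continuous_subtype_val.comp continuous_fst
    exact ((continuous_const.sub hu).mul
      ((continuous_coord b).comp (f.continuous.comp continuous_snd))).add
      (hu.mul ((continuous_coord b).comp (g.continuous.comp continuous_snd)))
  · intro x; ext b; simp
  · intro x; ext b; simp

end CubeModel

section Homotopies

open ContinuousMap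

variable {n : ℕ}

/-- Pushing the coordinate `0` to `1` retracts the cubical model of `D_σ`, for `σ` the face
opposite to the vertex `0`, to a sphere. -/
theorem cubeModel_facet_zero (d : ℕ) :
    Nonempty (cubeModel (d + 2) (facet 0) ≃ₕ cubeSphere d) := by
  let f : C(cubeModel (d + 2) (facet 0), cubeSphere d) :=
    ⟨fun x ↦ ⟨fun i ↦ x.1 i.succ, by
      obtain ⟨x, h, -, ⟨b, hb, hxb⟩, s, hs, hxs⟩ := x
      have hs' : s ≠ 0 := by simpa [facet] using hs
      exact ⟨fun i ↦ h _, ⟨b.pred hb, by simpa using hxb⟩, ⟨s.pred hs', by simpa using hxs⟩⟩⟩,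
      by exact Continuous.subtype_mk (continuous_pi fun i ↦ continuous_coord _) _⟩
  let g : C(cubeSphere d, cubeModel (d + 2) (facet 0)) :=
    ⟨fun y ↦ ⟨Fin.cons 1 y.1, by
      obtain ⟨y, h, ⟨i, hi⟩, j, hj⟩ := y
      refine ⟨fun b ↦ ?_, ⟨0, by simp, by simp⟩, ⟨i.succ, Fin.succ_ne_zero i, by simpa using hi⟩,
        j.succ, by simp [facet], by simpa using hj⟩
      refine Fin.cases (by simp) (fun i ↦ ?_) b
      simpa using h i⟩, by
      refine Continuous.subtype_mk (continuous_pi fun b ↦ Fin.cases ?_ (fun i ↦ ?_) b) _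
      · simpa using continuous_const
      · simpa using continuous_coord i⟩
  have hg0 : ∀ x, (g (f x)).1 0 = 1 := fun x ↦ rfl
  have hg : ∀ x b, b ≠ 0 → (g (f x)).1 b = x.1 b := fun x b hb ↦ by
    obtain ⟨i, rfl⟩ := Fin.exists_succ_eq.2 hb
    rfl
  refine ⟨⟨f, g, (cubeModel_homotopic (g.comp f) (ContinuousMap.id _) (fun x ↦ ?_) (fun x ↦ ?_)
    fun x ↦ ?_), ?_⟩⟩
  · obtain ⟨t, ht, hxt⟩ := x.2.2.1
    by_cases h : t = 0
    · exact ⟨0, by simp, hg0 x, h ▸ hxt⟩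
    · exact ⟨t, ht, (hg x t h).trans hxt, hxt⟩
  · obtain ⟨b, hb, hxb⟩ := x.2.2.2.1
    exact ⟨b, hb, (hg x b hb).trans hxb, hxb⟩
  · obtain ⟨s, hs, hxs⟩ := x.2.2.2.2
    exact ⟨s, hs, (hg x s (by simpa [facet] using hs)).trans hxs, hxs⟩
  · have : f.comp g = ContinuousMap.id _ := by
      ext y i
      rfl
    rw [this]

/-- Pushing the coordinates outside the triangle to `1` retracts the cubical model of `D_σ`, for
`σ` the triangle, to a sphere. -/
theorem cubeModel_triangle (hn : 3 ≤ n) :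
    Nonempty (cubeModel n (triangle n) ≃ₕ cubeSphere 1) := by
  let f : C(cubeModel n (triangle n), cubeSphere 1) :=
    ⟨fun x ↦ ⟨fun i ↦ x.1 (i.castLE (by omega)), by
      obtain ⟨x, h, ⟨t, ht, hxt⟩, -, s, hs, hxs⟩ := x
      rw [mem_triangle hn] at hs
      exact ⟨fun i ↦ h _, ⟨⟨t, by omega⟩, hxt⟩, ⟨⟨s, by omega⟩, hxs⟩⟩⟩,
      by exact Continuous.subtype_mk (continuous_pi fun i ↦ continuous_coord _) _⟩
  let g : C(cubeSphere 1, cubeModel n (triangle n)) :=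
    ⟨fun y ↦ ⟨fun b ↦ if h : (b : ℕ) < 3 then y.1 ⟨b, h⟩ else 1, by
      obtain ⟨y, h, ⟨i, hi⟩, j, hj⟩ := y
      refine ⟨fun b ↦ ?_, ⟨⟨i, by omega⟩, by dsimp only; omega, by simp [hi]⟩,
        ⟨⟨3, by omega⟩, by simp [Fin.ext_iff], by simp⟩,
        ⟨j, by omega⟩, (mem_triangle hn _).2 (by dsimp only; omega), by simp [hj]⟩
      dsimp only
      split_ifs with hb
      · exact h _
      · simp⟩, by
      refine Continuous.subtype_mk (continuous_pi fun b ↦ ?_) _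
      split_ifs with hb
      · exact continuous_coord _
      · exact continuous_const⟩
  have hg : ∀ x (b : Fin (n + 1)), (b : ℕ) < 3 → (g (f x)).1 b = x.1 b := fun x b hb ↦ dif_pos hb
  have hg1 : ∀ x (b : Fin (n + 1)), ¬ (b : ℕ) < 3 → (g (f x)).1 b = 1 := fun x b hb ↦ dif_neg hb
  refine ⟨⟨f, g, (cubeModel_homotopic (g.comp f) (ContinuousMap.id _) (fun x ↦ ?_) (fun x ↦ ?_)
    fun x ↦ ?_), ?_⟩⟩
  · obtain ⟨t, ht, hxt⟩ := x.2.2.1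
    exact ⟨t, ht, (hg x t (by omega)).trans hxt, hxt⟩
  · obtain ⟨b, hb, hxb⟩ := x.2.2.2.1
    refine ⟨b, hb, ?_, hxb⟩
    by_cases h : (b : ℕ) < 3
    · exact (hg x b h).trans hxb
    · exact hg1 x b h
  · obtain ⟨s, hs, hxs⟩ := x.2.2.2.2
    have := (mem_triangle hn s).1 hs
    exact ⟨s, hs, (hg x s (by omega)).trans hxs, hxs⟩
  · have : f.comp g = ContinuousMap.id _ := by
      ext y i
      exact dif_pos i.isLt
    rw [this]

/-- The cubical model of `D ∩ ∂Δ` is homotopy equivalent to a sphere: push the coordinates outside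
the triangle below the coordinate `0`, then the coordinate `0` to `1`. -/
theorem cubeModel_univ (d : ℕ) (hd : 1 ≤ d) :
    Nonempty (cubeModel (d + 2) Finset.univ ≃ₕ cubeSphere d) := by
  let lower (x : Fin (d + 3) → ℝ) (b : Fin (d + 3)) : ℝ :=
    if (b : ℕ) ≤ 2 then x b else min (x b) (x 0)
  have hlow : ∀ x (b : Fin (d + 3)), (b : ℕ) ≤ 2 → lower x b = x b := fun x b hb ↦ if_pos hb
  have hlow' : ∀ x (b : Fin (d + 3)), ¬ (b : ℕ) ≤ 2 → lower x b = min (x b) (x 0) := fun x b hb ↦ if_neg hb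
  have hlcont : ∀ b, Continuous fun x : cubeModel (d + 2) Finset.univ ↦ lower x.1 b := by
    intro b
    by_cases hb : (b : ℕ) ≤ 2
    · simpa only [hlow _ b hb] using continuous_coord b
    · simpa only [hlow' _ b hb] using (continuous_coord b).min (continuous_coord 0)
  have hlIcc : ∀ x ∈ cubeModel (d + 2) Finset.univ, ∀ b, lower x b ∈ Set.Icc 0 1 := by
    intro x hx b
    by_cases hb : (b : ℕ) ≤ 2
    · rw [hlow x b hb]; exact hx.1 b
    · rw [hlow' x b hb]
      exact ⟨le_min (hx.1 b).1 (hx.1 0).1, (min_le_left _ _).trans (hx.1 b).2⟩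
  have hlN : ∀ x ∈ cubeModel (d + 2) Finset.univ, ∃ b, b ≠ 0 ∧ x b = 1 ∧ lower x b = 1 := by
    rintro x ⟨hx, ⟨t, ht, hxt⟩, ⟨b, hb, hxb⟩, -⟩
    by_cases h : t = 0
    · subst h
      refine ⟨b, hb, hxb, ?_⟩
      by_cases hb : (b : ℕ) ≤ 2
      · rw [hlow x b hb, hxb]
      · rw [hlow' x b hb, hxb, hxt, min_self]
    · exact ⟨t, h, hxt, (hlow x t ht).trans hxt⟩
  have hlT : ∀ x ∈ cubeModel (d + 2) Finset.univ,
      ∃ t : Fin (d + 3), (t : ℕ) ≤ 2 ∧ x t = 1 ∧ lower x t = 1 := by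
    rintro x ⟨hx, ⟨t, ht, hxt⟩, -⟩
    exact ⟨t, ht, hxt, (hlow x t ht).trans hxt⟩
  have hl0 : ∀ x ∈ cubeModel (d + 2) Finset.univ, ∀ b, x b = 0 → lower x b = 0 := by
    intro x hx b hb
    by_cases hb2 : (b : ℕ) ≤ 2
    · rw [hlow x b hb2, hb]
    · rw [hlow' x b hb2, hb, min_eq_left (hx.1 0).1]
  have hlne : ∀ x ∈ cubeModel (d + 2) Finset.univ, ∃ s, s ≠ 0 ∧ lower x s = 0 := by
    intro x hx
    obtain ⟨s, -, hs⟩ := hx.2.2.2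
    by_cases h : s = 0
    · refine ⟨⟨3, by omega⟩, by simp [Fin.ext_iff], ?_⟩
      rw [hlow' _ _ (by simp), ← h, hs, min_eq_right (hx.1 _).1]
    · exact ⟨s, h, hl0 x hx s hs⟩
  let r : C(cubeModel (d + 2) Finset.univ, cubeModel (d + 2) Finset.univ) :=
    ⟨fun x ↦ ⟨lower x.1, by
      obtain ⟨t, ht, -, ht'⟩ := hlT x.1 x.2
      obtain ⟨b, hb, -, hb'⟩ := hlN x.1 x.2
      obtain ⟨s, -, hs⟩ := hlne x.1 x.2
      exact ⟨hlIcc x.1 x.2, ⟨t, ht, ht'⟩, ⟨b, hb, hb'⟩, s, Finset.mem_univ s, hs⟩⟩,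
      by exact Continuous.subtype_mk (continuous_pi hlcont) _⟩
  let f : C(cubeModel (d + 2) Finset.univ, cubeSphere d) :=
    ⟨fun x ↦ ⟨fun i ↦ lower x.1 i.succ, by
      obtain ⟨b, hb, -, hb'⟩ := hlN x.1 x.2
      obtain ⟨s, hs, hs'⟩ := hlne x.1 x.2
      exact ⟨fun i ↦ hlIcc x.1 x.2 _, ⟨b.pred hb, by simpa using hb'⟩,
        ⟨s.pred hs, by simpa using hs'⟩⟩⟩,
      by exact Continuous.subtype_mk (continuous_pi fun i ↦ hlcont _) _⟩
  let g : C(cubeSphere d, cubeModel (d + 2) Finset.univ) :=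
    ⟨fun y ↦ ⟨Fin.cons 1 y.1, by
      obtain ⟨y, h, ⟨i, hi⟩, j, hj⟩ := y
      refine ⟨fun b ↦ ?_, ⟨0, by simp, by simp⟩, ⟨i.succ, Fin.succ_ne_zero i, by simpa using hi⟩,
        j.succ, Finset.mem_univ _, by simpa using hj⟩
      refine Fin.cases (by simp) (fun i ↦ ?_) b
      simpa using h i⟩, by
      refine Continuous.subtype_mk (continuous_pi fun b ↦ Fin.cases ?_ (fun i ↦ ?_) b) _
      · simpa using continuous_const
      · simpa using continuous_coord i⟩
  have hg0 : ∀ x, (g (f x)).1 0 = 1 := fun x ↦ rfl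
  have hg : ∀ x b, b ≠ 0 → (g (f x)).1 b = lower x.1 b := fun x b hb ↦ by
    obtain ⟨i, rfl⟩ := Fin.exists_succ_eq.2 hb
    rfl
  have h₁ : (g.comp f).Homotopic r := by
    refine cubeModel_homotopic _ _ (fun x ↦ ?_) (fun x ↦ ?_) fun x ↦ ?_
    · obtain ⟨t, ht, -, ht'⟩ := hlT x.1 x.2
      by_cases h : t = 0
      · exact ⟨0, by simp, hg0 x, h ▸ ht'⟩
      · exact ⟨t, ht, (hg x t h).trans ht', ht'⟩
    · obtain ⟨b, hb, -, hb'⟩ := hlN x.1 x.2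
      exact ⟨b, hb, (hg x b hb).trans hb', hb'⟩
    · obtain ⟨s, hs, hs'⟩ := hlne x.1 x.2
      exact ⟨s, Finset.mem_univ s, (hg x s hs).trans hs', hs'⟩
  have h₂ : r.Homotopic (ContinuousMap.id _) := by
    refine cubeModel_homotopic _ _ (fun x ↦ ?_) (fun x ↦ ?_) fun x ↦ ?_
    · obtain ⟨t, ht, ht', ht''⟩ := hlT x.1 x.2
      exact ⟨t, ht, ht'', ht'⟩
    · obtain ⟨b, hb, hb', hb''⟩ := hlN x.1 x.2
      exact ⟨b, hb, hb'', hb'⟩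
    · obtain ⟨s, hs, hs'⟩ := x.2.2.2.2
      exact ⟨s, hs, hl0 x.1 x.2 s hs', hs'⟩
  refine ⟨⟨f, g, h₁.trans h₂, ?_⟩⟩
  have : f.comp g = ContinuousMap.id _ := by
    ext y i
    change lower (Fin.cons 1 y.1) i.succ = y.1 i
    by_cases hi : (i.succ : ℕ) ≤ 2
    · rw [hlow _ _ hi, Fin.cons_succ]
    · rw [hlow' _ _ hi, Fin.cons_succ, Fin.cons_zero, min_eq_left (y.2.1 i).2]
  rw [this]

/-- For `σ` strictly between the triangle and the whole simplex, the cubical model of `D_σ` is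
contractible: push the coordinates outside `σ` to `1`, then those in `σ` outside the triangle to
`0`, then those in the triangle to `1`. -/
theorem contractibleSpace_cubeModel (hn : 3 ≤ n) {σ : Finset (Fin (n + 1))}
    (h₁ : triangle n ⊂ σ) (h₂ : σ ⊂ Finset.univ) : ContractibleSpace (cubeModel n σ) := by
  obtain ⟨a, haσ, haT⟩ := Finset.exists_of_ssubset h₁
  obtain ⟨b, -, hbσ⟩ := Finset.exists_of_ssubset h₂
  rw [mem_triangle hn] at haT
  have hT : ∀ t : Fin (n + 1), (t : ℕ) ≤ 2 → t ∈ σ := fun t ht ↦ h₁.1 ((mem_triangle hn t).2 ht)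
  have hb : b ≠ 0 := by
    rintro rfl
    exact hbσ (hT 0 (by simp))
  have hp : ∀ x ∈ cubeModel n σ, (fun c ↦ if c ∈ σ then x c else 1) ∈ cubeModel n σ := by
    rintro x ⟨hx, ⟨t, ht, hxt⟩, -, s, hs, hxs⟩
    refine ⟨fun c ↦ ?_, ⟨t, ht, ?_⟩, ⟨b, hb, if_neg hbσ⟩, s, hs, (if_pos hs).trans hxs⟩
    · dsimp only
      split_ifs
      · exact hx c
      · simp
    · exact (if_pos (hT t ht)).trans hxt
  have hq : ∀ x ∈ cubeModel n σ,
      (fun c ↦ if c ∈ σ then if (c : ℕ) ≤ 2 then x c else 0 else 1) ∈ cubeModel n σ := by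
    rintro x ⟨hx, ⟨t, ht, hxt⟩, -, -⟩
    refine ⟨fun c ↦ ?_, ⟨t, ht, ?_⟩, ⟨b, hb, if_neg hbσ⟩, a, haσ, (if_pos haσ).trans (if_neg haT)⟩
    · dsimp only
      split_ifs
      · exact hx c
      · simp
      · simp
    · exact (if_pos (hT t ht)).trans ((if_pos ht).trans hxt)
  have hc : (fun c : Fin (n + 1) ↦ if c ∈ σ then if (c : ℕ) ≤ 2 then (1 : ℝ) else 0 else 1) ∈
      cubeModel n σ := by
    refine ⟨fun c ↦ ?_, ⟨0, by simp, ?_⟩, ⟨b, hb, if_neg hbσ⟩, a, haσ,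
      (if_pos haσ).trans (if_neg haT)⟩
    · dsimp only
      split_ifs <;> simp
    · exact (if_pos (hT 0 (by simp))).trans (if_pos (by simp))
  let p : C(cubeModel n σ, cubeModel n σ) := ⟨fun x ↦ ⟨_, hp x.1 x.2⟩, by
    refine Continuous.subtype_mk (continuous_pi fun c ↦ ?_) _
    split_ifs
    · exact continuous_coord c
    · exact continuous_const⟩
  let q : C(cubeModel n σ, cubeModel n σ) := ⟨fun x ↦ ⟨_, hq x.1 x.2⟩, by
    refine Continuous.subtype_mk (continuous_pi fun c ↦ ?_) _
    split_ifs
    · exact continuous_coord c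
    · exact continuous_const
    · exact continuous_const⟩
  rw [contractible_iff_id_nullhomotopic]
  refine ⟨⟨_, hc⟩, Homotopic.trans (g := p) ?_ (Homotopic.trans (g := q) ?_ ?_)⟩
  · refine cubeModel_homotopic _ _ (fun x ↦ ?_) (fun x ↦ ?_) fun x ↦ ?_
    · obtain ⟨t, ht, hxt⟩ := x.2.2.1
      exact ⟨t, ht, hxt, (if_pos (hT t ht)).trans hxt⟩
    · obtain ⟨c, hc, hxc⟩ := x.2.2.2.1
      refine ⟨c, hc, hxc, ?_⟩
      by_cases h : c ∈ σ
      · exact (if_pos h).trans hxc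
      · exact if_neg h
    · obtain ⟨s, hs, hxs⟩ := x.2.2.2.2
      exact ⟨s, hs, hxs, (if_pos hs).trans hxs⟩
  · refine cubeModel_homotopic _ _ (fun x ↦ ?_) (fun x ↦ ?_) fun x ↦ ?_
    · obtain ⟨t, ht, hxt⟩ := x.2.2.1
      exact ⟨t, ht, (if_pos (hT t ht)).trans hxt, (if_pos (hT t ht)).trans ((if_pos ht).trans hxt)⟩
    · exact ⟨b, hb, if_neg hbσ, if_neg hbσ⟩
    · obtain ⟨s, hs, hxs⟩ := x.2.2.2.2
      refine ⟨s, hs, (if_pos hs).trans hxs, (if_pos hs).trans ?_⟩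
      split_ifs
      · exact hxs
      · rfl
  · refine cubeModel_homotopic _ _ (fun x ↦ ?_) (fun x ↦ ?_) fun x ↦ ?_
    · obtain ⟨t, ht, hxt⟩ := x.2.2.1
      exact ⟨t, ht, (if_pos (hT t ht)).trans ((if_pos ht).trans hxt),
        (if_pos (hT t ht)).trans (if_pos ht)⟩
    · exact ⟨b, hb, if_neg hbσ, if_neg hbσ⟩
    · exact ⟨a, haσ, (if_pos haσ).trans (if_neg haT), (if_pos haσ).trans (if_neg haT)⟩

end Homotopies

section Conclusion

open ContinuousMap

variable {n : ℕ} {W : Type*} [Group W]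

lemma hasCohomologyOfSphere_of_cubeModel (hn : 3 ≤ n) (cs : CoxeterSystem (coxeterMatrixAff n) W)
    {σ : Finset (Fin (n + 1))} {d : ℕ} (h : Nonempty (cubeModel n σ ≃ₕ cubeSphere d)) :
    HasCohomologyOfSphere (subchamber cs σ) d := by
  obtain ⟨e⟩ := h
  intro R _ A k
  exact singularCohomology_iso_of_homotopyEquiv R A
    (((subchamberHomeomorph hn cs σ).toHomotopyEquiv.trans e).trans
      (cubeSphereHomeomorph d).toHomotopyEquiv) k

lemma facesNotContaining_triangle (n : ℕ) : facesNotContaining (triangle n) =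
    face (facet 0) ∪ face (facet 1) ∪ face (facet 2) := by
  rw [facesNotContaining_eq, triangle]
  simp only [Finset.set_biUnion_insert, Finset.set_biUnion_singleton, Set.union_assoc]

end Conclusion

end DavisChamber

theorem mainTheorem5 (n : ℕ) (hn : 3 ≤ n) {W : Type*} [Group W]
    (cs : CoxeterSystem (DavisChamber.coxeterMatrixAff n) W) :
    (DavisChamber.subchamber cs (DavisChamber.facet 0) =
        (⋃ (j : Fin (n + 1)) (_ : j ≠ 0),
          DavisChamber.chamber cs ∩ DavisChamber.face (DavisChamber.facet j)) ∧
      DavisChamber.HasCohomologyOfSphere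
        (DavisChamber.subchamber cs (DavisChamber.facet 0)) (n - 2)) ∧
    (DavisChamber.subchamber cs Finset.univ =
        DavisChamber.chamber cs ∩ DavisChamber.simplexBoundary (Fin (n + 1)) ∧
      DavisChamber.HasCohomologyOfSphere
        (DavisChamber.subchamber cs Finset.univ) (n - 2)) ∧
    (∃! τ : Finset (Fin (n + 1)), τ.Nonempty ∧
      DavisChamber.facesNotContaining τ =
        DavisChamber.face (DavisChamber.facet 0) ∪ DavisChamber.face (DavisChamber.facet 1) ∪
          DavisChamber.face (DavisChamber.facet 2)) ∧
    (∀ τ : Finset (Fin (n + 1)), τ.Nonempty →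
      DavisChamber.facesNotContaining τ =
        DavisChamber.face (DavisChamber.facet 0) ∪ DavisChamber.face (DavisChamber.facet 1) ∪
          DavisChamber.face (DavisChamber.facet 2) →
      DavisChamber.HasCohomologyOfSphere (DavisChamber.subchamber cs τ) 1 ∧
      ∀ σ : Finset (Fin (n + 1)), τ ⊂ σ → σ ⊂ Finset.univ →
        ContractibleSpace (DavisChamber.subchamber cs σ)) := by
  have : Nontrivial (Fin (n + 1)) := Fin.nontrivial_iff_two_le.2 (by omega)
  have hτ : ∀ τ : Finset (Fin (n + 1)), DavisChamber.facesNotContaining τ =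
      DavisChamber.face (DavisChamber.facet 0) ∪ DavisChamber.face (DavisChamber.facet 1) ∪
        DavisChamber.face (DavisChamber.facet 2) → τ = DavisChamber.triangle n := fun τ h ↦
    DavisChamber.facesNotContaining_injective
      (h.trans (DavisChamber.facesNotContaining_triangle n).symm)
  refine ⟨⟨?_, ?_⟩, ⟨?_, ?_⟩, ⟨DavisChamber.triangle n, ⟨⟨0, by simp [DavisChamber.triangle]⟩,
    DavisChamber.facesNotContaining_triangle n⟩, fun τ h ↦ hτ τ h.2⟩, fun τ _ h ↦ ?_⟩
  · rw [DavisChamber.subchamber, DavisChamber.facesNotContaining_eq]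
    simp only [Set.inter_iUnion, DavisChamber.facet, Finset.mem_compl, Finset.mem_singleton, ne_eq]
  · obtain ⟨d, rfl⟩ : ∃ d, n = d + 2 := ⟨n - 2, by omega⟩
    exact DavisChamber.hasCohomologyOfSphere_of_cubeModel hn cs (DavisChamber.cubeModel_facet_zero d)
  · rw [DavisChamber.subchamber, DavisChamber.facesNotContaining_eq, DavisChamber.simplexBoundary]
    simp only [Finset.mem_univ, Set.iUnion_true]
  · obtain ⟨d, rfl⟩ : ∃ d, n = d + 2 := ⟨n - 2, by omega⟩
    exact DavisChamber.hasCohomologyOfSphere_of_cubeModel hn cs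
      (DavisChamber.cubeModel_univ d (by omega))
  · obtain rfl := hτ τ h
    refine ⟨DavisChamber.hasCohomologyOfSphere_of_cubeModel hn cs
      (DavisChamber.cubeModel_triangle hn), fun σ h₁ h₂ ↦ ?_⟩
    have := DavisChamber.contractibleSpace_cubeModel hn h₁ h₂
    exact (DavisChamber.subchamberHomeomorph hn cs σ).contractibleSpace
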